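/- **Definitions.** A *violator space* is a pair $(H,\mathsf V)$ with $H$ a finite set and $\mathsf V\colon 2^H\to 2^H$ such that $G\cap\mathsf V(G)=\emptyset$ for all $G\subseteq H$ (consistency), and $\mathsf V(G)=\mathsf V(F)$ whenever $F\subseteq G\subseteq H$ and $G\cap\mathsf V(F)=\emptyset$ (locality); no acyclicity is assumed. A set $B\subseteq H$ is a *basis* if $B\cap\mathsf V(F)\neq\emptyset$ for every proper subset $F\subset B$; a *basis of $G$* is an inclusion-minimal subset $B\subseteq G$ with $\mathsf V(B)=\mathsf V(G)$. The *combinatorial dimension* $\delta$ of $(H,\mathsf V)$ is the size of a largest basis. The map $\mathsf V$ is accessible only through the *violation test*: given $G\subseteq H$ and $h\in H\setminus G$, decide whether $h\in\mathsf V(G)$. **Algorithms** (with $H$ and $\delta$ known; all random choices uniform and independent). * $\mathrm{Trivial}(G)$: go through the subsets $B\subseteq G$ with $|B|\le\delta$ and return the first one such that $h\in\mathsf V(B\setminus\{h\})$ for all $h\in B$ and $h\notin\mathsf V(B)$ for all $h\in G\setminus B$. * $\mathrm{Basis2}(G)$: if $|G|\le 6\delta^2$, return $\mathrm{Trivial}(G)$.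 Otherwise let $\mu(h)=1$ for all $h$ and repeat: choose a random sub-multiset $R$ of size $6\delta^2$ of the multiset that contains $\mu(h)$ copies of each $h\in G$; let $C=\mathrm{Trivial}(R)$, where $R$ is viewed as a set; test all $h\in G\setminus C$ to find $X=\{h\in G\setminus C: h\in\mathsf V(C)\}$; if $X=\emptyset$, return $C$; if $3\delta\sum_{h\in X}\mu(h)\le\sum_{h\in G}\mu(h)$, double $\mu(h)$ for all $h\in X$. * $\mathrm{Basis1}(G)$: if $|G|\le 9\delta^2$, return $\mathrm{Basis2}(G)$. Otherwise let $W=\emptyset$ and repeat: choose a random subset $R\subseteq G$ of size $\lfloor\delta\sqrt{|G|}\rfloor$; let $C=\mathrm{Basis2}(W\cup R)$; test all $h\in G\setminus C$ to find $X=\{h\in G\setminus C: h\in\mathsf V(C)\}$; if $X=\emptyset$, return $C$; if $|X|\le 2\sqrt{|G|}$, replace $W$ by $W\cup X$. **Theorem.** There are absolute constants $C,c\in\mathbb N$ such that for every violator space $(H,\mathsf V)$ (possibly cyclic) with $|H|=n$ and combinatorial dimension $\delta$, the algorithm $\mathrm{Basis1}(H)$ halts with probability $1$ and its output is, with probability $1$,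 a basis of $H$. If $\delta\ge1$, then the expected number of calls to the violation test, including those made inside $\mathrm{Basis2}$ and $\mathrm{Trivial}$, is at most $$C\left(\delta n+\delta^{c\delta}\right),$$ that is, $O\bigl(\delta n+\delta^{O(\delta)}\bigr)$. If $\delta=0$, it is at most $n$. -/

import Mathlib

open scoped ENNReal

universe u

/-! Violator spaces on a finite set `H`, given by a map `V : 2^H → 2^H`. -/

/-- `(H, V)` is a violator space: consistency and locality. No acyclicity is required. -/
structure IsViolatorSpace {H : Type u} [DecidableEq H] (V : Finset H → Finset H) : Prop where
  consistency : ∀ G : Finset H, G ∩ V G = ∅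
  locality : ∀ F G : Finset H, F ⊆ G → G ∩ V F = ∅ → V G = V F

/-- `B` is a basis: `B ∩ V(F) ≠ ∅` for every proper subset `F` of `B`. -/
def IsBasis {H : Type u} [DecidableEq H] (V : Finset H → Finset H) (B : Finset H) : Prop :=
  ∀ F : Finset H, F ⊂ B → B ∩ V F ≠ ∅

/-- `B` is a basis of `G`: an inclusion-minimal subset of `G` with `V(B) = V(G)`. -/
def IsBasisOf {H : Type u} (V : Finset H → Finset H) (B G : Finset H) : Prop :=
  Minimal (fun B' : Finset H => B' ⊆ G ∧ V B' = V G) B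

open Classical in
/-- The combinatorial dimension: the size of a largest basis. -/
noncomputable def combDim {H : Type u} [Fintype H] [DecidableEq H]
    (V : Finset H → Finset H) : ℕ :=
  ((Finset.univ : Finset (Finset H)).filter (IsBasis V)).sup Finset.card

/-! Randomized programs whose only access to the violator map is the violation test. -/

/-- A randomized program over the ground set `H` with output in `α`. The violator map is not an
argument: a program learns about it only through `query`.
* `ret a` halts with output `a`;
* `query G h k` calls the primitive "is `h ∈ V(G)`?" and continues with the answer;
* `choose s k` draws an element of the finite set `s` uniformly at random, independently of
  everything before, and continues with it;
* `bind p k` runs the subroutine `p` and continues with its output;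
* `loop body s` runs `body` on the state `s`; if the outcome is `inl s'`, it repeats with the
  state `s'`, and if the outcome is `inr a`, it leaves the loop with result `a`. -/
inductive Prog (H : Type u) : Type u → Type (u + 1) where
  | ret {α : Type u} (a : α) : Prog H α
  | query {α : Type u} (G : Finset H) (h : H) (k : Bool → Prog H α) : Prog H α
  | choose {α β : Type u} (s : Finset β) (k : β → Prog H α) : Prog H α
  | bind {α β : Type u} (p : Prog H β) (k : β → Prog H α) : Prog H α
  | loop {α σ : Type u} (body : σ → Prog H (σ ⊕ α)) (init : σ) : Prog H α

namespace Prog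

/-- Sequencing of outcomes `(output, number of calls)`: `none` means that the run was cut off
(nothing is run after it); otherwise continue, and add up the numbers of calls. -/
noncomputable def seqOutcome {α β : Type u} (p : PMF (Option β × ℕ))
    (k : β → PMF (Option α × ℕ)) : PMF (Option α × ℕ) :=
  p.bind fun x =>
    match x.1 with
    | none => PMF.pure (none, x.2)
    | some b => (k b).map fun y => (y.1, x.2 + y.2)

/-- At most `n` rounds of a loop whose body has the outcome distribution `f s` on the state `s`. -/
noncomputable def iterOutcome {α σ : Type u} (f : σ → PMF (Option (σ ⊕ α) × ℕ)) :
    ℕ → σ → PMF (Option α × ℕ)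
  | 0, _ => PMF.pure (none, 0)
  | n + 1, s => seqOutcome (f s) fun r =>
      match r with
      | Sum.inl s' => iterOutcome f n s'
      | Sum.inr a => PMF.pure (some a, 0)

/-- The joint distribution of the output and of the number of calls to the primitive, when the
program runs on the violator map `V` and is cut off (output `none`) as soon as some loop has made
`t` rounds without being left. A draw from the empty set also gives `none`. -/
noncomputable def run {H : Type u} [DecidableEq H] (V : Finset H → Finset H) (t : ℕ) :
    {α : Type u} → Prog H α → PMF (Option α × ℕ)
  | _, ret a => PMF.pure (some a, 0)
  | _, query G h k => (run V t (k (decide (h ∈ V G)))).map fun y => (y.1, y.2 + 1)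
  | _, choose s k =>
      if hs : s.Nonempty then (PMF.uniformOfFinset s hs).bind fun b => run V t (k b)
      else PMF.pure (none, 0)
  | _, bind p k => seqOutcome (run V t p) fun b => run V t (k b)
  | _, loop body init => iterOutcome (fun s => run V t (body s)) t init

/-- The probability that the program halts with an output in `S`: the limit, which is the
supremum, over the cut-offs `t`, of the probability to do so before the cut-off. -/
noncomputable def outputProb {H α : Type u} [DecidableEq H] (V : Finset H → Finset H)
    (p : Prog H α) (S : Set α) : ℝ≥0∞ :=
  ⨆ t : ℕ, (run V t p).toOuterMeasure {x | ∃ a ∈ S, x.1 = some a}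

/-- The expected number of calls to the primitive (over all runs, halting or not): the limit,
which is the supremum, of the expected number of calls before the cut-off `t`. -/
noncomputable def expectedCalls {H α : Type u} [DecidableEq H] (V : Finset H → Finset H)
    (p : Prog H α) : ℝ≥0∞ :=
  ⨆ t : ℕ, ∑' x : Option α × ℕ, run V t p x * (x.2 : ℝ≥0∞)

end Prog

/-! Clarkson's algorithms. -/

namespace Clarkson

variable {H : Type u} [DecidableEq H]

/-- Computes `{h ∈ L : h ∈ V(C)}`, with one call for each member of the list `L`. -/
def violators (C : Finset H) : List H → Prog H (Finset H)
  | [] => Prog.ret ∅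
  | h :: L => Prog.query C h fun b =>
      Prog.bind (violators C L) fun S => Prog.ret (if b then insert h S else S)

/-- Makes the listed tests `(F, h, b)`, "is the answer to `h ∈ V(F)` equal to `b`?", one by one;
continues with `yes` if all succeed and with `no` at the first failure. -/
def checkAll {α : Type u} (yes no : Prog H α) : List (Finset H × H × Bool) → Prog H α
  | [] => yes
  | (F, h, b) :: L => Prog.query F h fun a => if a = b then checkAll yes no L else no

/-- The tests by which `B ⊆ G` is recognized as a basis of `G`: `h ∈ V(B \ {h})` for all `h ∈ B`,
and `h ∉ V(B)` for all `h ∈ G \ B`. -/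
noncomputable def basisTests (G B : Finset H) : List (Finset H × H × Bool) :=
  B.toList.map (fun h => (B.erase h, h, true)) ++ (G \ B).toList.map (fun h => (B, h, false))

/-- Returns the first candidate in the list that passes the tests for being a basis of `G`
(and `∅` if there is none). -/
noncomputable def firstBasis (G : Finset H) : List (Finset H) → Prog H (Finset H)
  | [] => Prog.ret ∅
  | B :: L => checkAll (Prog.ret B) (firstBasis G L) (basisTests G B)

/-- The trivial algorithm: go through all subsets of `G` of size at most `δ`. -/
noncomputable def trivialAlg (δ : ℕ) (G : Finset H) : Prog H (Finset H) :=
  firstBasis G (G.powerset.filter fun B => B.card ≤ δ).toList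

/-- The multiset in which each `h ∈ G` has multiplicity `μ h`, as a set of labelled copies. -/
def copies (G : Finset H) (μ : H → ℕ) : Finset (Σ _ : H, ℕ) :=
  G.sigma fun h => Finset.range (μ h)

/-- Clarkson's second algorithm (reweighting). -/
noncomputable def basis2 (δ : ℕ) (G : Finset H) : Prog H (Finset H) :=
  if G.card ≤ 6 * δ ^ 2 then trivialAlg δ G
  else
    Prog.loop
      (fun μ : H → ℕ =>
        Prog.choose ((copies G μ).powersetCard (6 * δ ^ 2)) fun R =>
        Prog.bind (trivialAlg δ (R.image Sigma.fst)) fun C =>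
        Prog.bind (violators C (G \ C).toList) fun X =>
        Prog.ret
          (if X = ∅ then Sum.inr C
          else if 3 * δ * ∑ h ∈ X, μ h ≤ ∑ h ∈ G, μ h then
            Sum.inl fun h => if h ∈ X then 2 * μ h else μ h
          else Sum.inl μ))
      (fun _ => 1)

/-- Clarkson's first algorithm (working set), with `basis2` as a subroutine. -/
noncomputable def basis1 (δ : ℕ) (G : Finset H) : Prog H (Finset H) :=
  if G.card ≤ 9 * δ ^ 2 then basis2 δ G
  else
    Prog.loop
      (fun W : Finset H =>
        Prog.choose (G.powersetCard ⌊(δ : ℝ) * √(G.card : ℝ)⌋₊) fun R =>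
        Prog.bind (basis2 δ (W ∪ R)) fun C =>
        Prog.bind (violators C (G \ C).toList) fun X =>
        Prog.ret
          (if X = ∅ then Sum.inr C
          else if (X.card : ℝ) ≤ 2 * √(G.card : ℝ) then Sum.inl (W ∪ X)
          else Sum.inl W))
      ∅

end Clarkson

/-!
Every sample is judged by its violators: if no element of a fixed basis `B` of `G` violates a set
`C ⊆ G`, then by locality `C` has the same violators as `G` (`IsBasisOf.violators_eq`), so a round
of either algorithm ends the loop with a basis of `G` or catches an element of `B`. This replaces
the arguments by a monotone objective function and needs no acyclicity. The sampling lemma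
(`sum_card_violators_le`) counts pairs of a sample `R` and a copy violating it as extreme copies of
samples with one more element, of which there are at most `δ` per sample; with Markov's inequality
(`two_mul_card_bad_le`), a round is successful with probability at least `1/2`.

Expectations are handled by a calculus of upper bounds. `Prog.cost` is the expected number of calls
plus the expected value of a continuation cost of the output, where a cut-off run is penalized by
`c * t`. A potential that pays for each round of a loop, with a charge of `c` per round, bounds the
cost of the loop (`Prog.cost_loop_le`). With `c = 0` this bounds the expected number of calls,
uniformly in the cut-off `t`. With `c = 1` and the continuation cost `⊤` on wrong outputs, a finite
bound makes the probability of a cut-off `O(1/t)` and that of a wrong output `0`, which is almost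
sure termination and correctness (`Prog.outputProb_eq_one`).

For the reweighting algorithm the potential is linear in
`δ log₂ (∑_{h ∈ G} μ h) - ∑_{h ∈ B} log₂ (μ h)`. It is nonnegative as `|B| ≤ δ`, it starts at
`δ log₂ |G|`, and a successful round raises the first term by at most `1 / (3 log 2) ≤ 1/2` and the
second by at least `1`; so there are `O(δ log |G|)` rounds in expectation. For the working set
algorithm the potential is linear in `|B \ W|`, and as `W` gains at most `2 √n` elements whenever
it gains one of `B`, the reweighting algorithm runs on at most `3 δ √n` elements. The bounds are
compared with `δ n + δ^(40 δ)` through the fourth root of `n`, against which `log n` is negligible.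
-/

/-! ### Bases in violator spaces -/

section ViolatorSpace

variable {H : Type u} {V : Finset H → Finset H}

theorem exists_isBasisOf (V : Finset H → Finset H) (G : Finset H) : ∃ B, IsBasisOf V B G := by
  obtain ⟨B, -, hB⟩ := exists_minimal_le_of_wellFoundedLT
    (fun B' : Finset H => B' ⊆ G ∧ V B' = V G) G ⟨subset_rfl, rfl⟩
  exact ⟨B, hB⟩

theorem IsBasisOf.of_violators_eq {B F G : Finset H} (hB : IsBasisOf V B F) (hF : F ⊆ G)
    (h : V F = V G) : IsBasisOf V B G :=
  ⟨⟨hB.1.1.trans hF, hB.1.2.trans h⟩, fun _ hF' hFB =>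
    hB.2 ⟨hFB.trans hB.1.1, hF'.2.trans h.symm⟩ hFB⟩

variable [DecidableEq H]

theorem IsViolatorSpace.notMem_of_mem (hV : IsViolatorSpace V) {G : Finset H} {h : H}
    (hh : h ∈ V G) : h ∉ G := fun hG => by
  have := hV.consistency G
  exact absurd (Finset.mem_inter.2 ⟨hG, hh⟩) (by simp [this])

theorem IsBasisOf.isBasis (hV : IsViolatorSpace V) {B G : Finset H} (hB : IsBasisOf V B G) :
    IsBasis V B := by
  intro F hF hdis
  have h1 : V B = V F := hV.locality F B hF.subset hdis
  exact hF.not_subset (hB.2 ⟨hF.subset.trans hB.1.1, h1.symm.trans hB.1.2⟩ hF.subset)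

theorem IsBasis.card_le_combDim [Fintype H] {B : Finset H} (hB : IsBasis V B) :
    B.card ≤ combDim V := by
  classical
  unfold combDim
  exact Finset.le_sup (f := Finset.card) (by simpa using hB)

/-- The tests made by the trivial algorithm recognize precisely the bases of `G`. -/
theorem isBasisOf_iff_tests (hV : IsViolatorSpace V) {B G : Finset H} (hBG : B ⊆ G) :
    IsBasisOf V B G ↔ (∀ h ∈ B, h ∈ V (B.erase h)) ∧ ∀ h ∈ G \ B, h ∉ V B := by
  constructor
  · intro hB
    refine ⟨fun h hh => ?_, fun h hh hVB => ?_⟩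
    · obtain ⟨x, hx⟩ := Finset.nonempty_iff_ne_empty.2
        (hB.isBasis hV _ (Finset.erase_ssubset hh))
      rw [Finset.mem_inter] at hx
      have := hV.notMem_of_mem hx.2
      simp only [Finset.mem_erase, not_and] at this
      by_cases hxh : x = h
      · exact hxh ▸ hx.2
      · exact absurd hx.1 (this hxh)
    · rw [hB.1.2] at hVB
      exact hV.notMem_of_mem hVB (Finset.mem_sdiff.1 hh).1
  · rintro ⟨h1, h2⟩
    have hVG : V G = V B := by
      refine hV.locality B G hBG (Finset.eq_empty_of_forall_notMem fun x hx => ?_)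
      rw [Finset.mem_inter] at hx
      exact h2 x (Finset.mem_sdiff.2 ⟨hx.1, hV.notMem_of_mem hx.2⟩) hx.2
    refine ⟨⟨hBG, hVG.symm⟩, fun F hF hFB h hh => ?_⟩
    by_contra hhF
    have hsub : F ⊆ B.erase h := fun x hx =>
      Finset.mem_erase.2 ⟨fun hxh => hhF (hxh ▸ hx), hFB hx⟩
    have hVF : V F = V B := hF.2.trans hVG
    have h3 : V (B.erase h) = V F := by
      refine hV.locality _ _ hsub (Finset.eq_empty_of_forall_notMem fun x hx => ?_)
      rw [Finset.mem_inter, hVF] at hx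
      exact hV.notMem_of_mem hx.2 (Finset.mem_of_mem_erase hx.1)
    have h4 := h1 h hh
    rw [h3, hVF] at h4
    exact hV.notMem_of_mem h4 hh

/-- If no element of a basis `B` of `G` violates `C ⊆ G`, then `C` has the same violators as `G`.
This is what forces every violated sample to catch an element of `B`. -/
theorem IsBasisOf.violators_eq (hV : IsViolatorSpace V) {B C G : Finset H}
    (hB : IsBasisOf V B G) (hC : C ⊆ G) (hdis : ∀ h ∈ B, h ∉ V C) : V C = V G := by
  have h1 : V (C ∪ B) = V C := by
    refine hV.locality _ _ Finset.subset_union_left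
      (Finset.eq_empty_of_forall_notMem fun x hx => ?_)
    rw [Finset.mem_inter, Finset.mem_union] at hx
    rcases hx with ⟨hx | hx, hx'⟩
    · exact hV.notMem_of_mem hx' hx
    · exact hdis x hx hx'
  have h2 : V (C ∪ B) = V B := by
    refine hV.locality _ _ Finset.subset_union_right
      (Finset.eq_empty_of_forall_notMem fun x hx => ?_)
    rw [Finset.mem_inter, hB.1.2] at hx
    exact hV.notMem_of_mem hx.2 (Finset.union_subset hC hB.1.1 hx.1)
  rw [← h1, h2, hB.1.2]

/-- An extreme element of a set belongs to each of its bases. -/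
theorem IsBasisOf.mem_of_extreme (hV : IsViolatorSpace V) {B U : Finset H} {h : H}
    (hB : IsBasisOf V B (insert h U)) (hh : h ∈ V U) : h ∈ B := by
  by_contra hhB
  have hBU : B ⊆ U := (Finset.subset_insert_iff_of_notMem hhB).1 hB.1.1
  have hVU : V U = V B := by
    refine hV.locality _ _ hBU (Finset.eq_empty_of_forall_notMem fun x hx => ?_)
    rw [Finset.mem_inter, hB.1.2] at hx
    exact hV.notMem_of_mem hx.2 (Finset.mem_insert_of_mem hx.1)
  rw [hVU, hB.1.2] at hh
  exact hV.notMem_of_mem hh (Finset.mem_insert_self _ _)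

/-! ### The sampling lemma -/

/-- For labelled copies `x` of elements `π x`, at most `δ` of the copies in `Q` are violated by
the remaining ones together with `W`: they have distinct labels, all of them in a basis. -/
theorem card_extreme_le (hV : IsViolatorSpace V) {δ : ℕ} (hδ : ∀ B, IsBasis V B → B.card ≤ δ)
    {β : Type*} [DecidableEq β] (π : β → H) (W : Finset H) (Q : Finset β) :
    (Q.filter fun x => π x ∈ V (W ∪ (Q.erase x).image π)).card ≤ δ := by
  obtain ⟨B, hB⟩ := exists_isBasisOf V (W ∪ Q.image π)
  refine le_trans (Finset.card_le_card_of_injOn π ?_ ?_) (hδ B (hB.isBasis hV))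
  · intro x hx
    simp only [Finset.coe_filter, Set.mem_ofPred_eq] at hx
    have hins : W ∪ Q.image π = insert (π x) (W ∪ (Q.erase x).image π) := by
      rw [← Finset.union_insert, ← Finset.image_insert, Finset.insert_erase hx.1]
    rw [hins] at hB
    exact hB.mem_of_extreme hV hx.2
  · intro x hx y hy hxy
    simp only [Finset.coe_filter, Set.mem_ofPred_eq] at hx hy
    by_contra hne
    refine hV.notMem_of_mem hx.2 (Finset.mem_union_right _ ?_)
    rw [hxy]
    exact Finset.mem_image_of_mem _ (Finset.mem_erase.2 ⟨fun h => hne h.symm, hy.1⟩)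

/-- Sampling lemma, in counting form: a violated pair (sample, copy outside the sample) is an
extreme copy in a set with one more element. -/
theorem sum_card_violators_le (hV : IsViolatorSpace V) {δ : ℕ}
    (hδ : ∀ B, IsBasis V B → B.card ≤ δ) {β : Type*} [DecidableEq β] (S : Finset β) (π : β → H)
    (W : Finset H) (r : ℕ) :
    ∑ R ∈ S.powersetCard r, (S.filter fun x => π x ∈ V (W ∪ R.image π)).card ≤
      δ * S.card.choose (r + 1) := by
  calc ∑ R ∈ S.powersetCard r, (S.filter fun x => π x ∈ V (W ∪ R.image π)).card
      = ((S.powersetCard r).sigma fun R => S.filter fun x => π x ∈ V (W ∪ R.image π)).card :=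
        (Finset.card_sigma _ _).symm
    _ ≤ ((S.powersetCard (r + 1)).sigma fun Q =>
          Q.filter fun x => π x ∈ V (W ∪ (Q.erase x).image π)).card := by
        have hnot : ∀ (R : Finset β) (x : β), π x ∈ V (W ∪ R.image π) → x ∉ R := fun R x hx hxR =>
          hV.notMem_of_mem hx (Finset.mem_union_right _ (Finset.mem_image_of_mem _ hxR))
        refine Finset.card_le_card_of_injOn (fun p => ⟨insert p.2 p.1, p.2⟩) ?_ ?_
        · rintro ⟨R, x⟩ hp
          simp only [Finset.coe_sigma, Set.mem_sigma_iff, Finset.mem_coe,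
            Finset.mem_powersetCard, Finset.mem_filter] at hp ⊢
          obtain ⟨⟨hRS, hRc⟩, hxS, hx⟩ := hp
          have hxR := hnot R x hx
          refine ⟨⟨Finset.insert_subset hxS hRS, by rw [Finset.card_insert_of_notMem hxR, hRc]⟩,
            Finset.mem_insert_self _ _, ?_⟩
          rwa [Finset.erase_insert hxR]
        · rintro ⟨R, x⟩ hp ⟨R', x'⟩ hp' heq
          simp only [Finset.coe_sigma, Set.mem_sigma_iff, Finset.mem_coe,
            Finset.mem_powersetCard, Finset.mem_filter] at hp hp'
          simp only [Sigma.mk.injEq, heq_eq_eq] at heq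
          obtain ⟨h1, rfl⟩ := heq
          have : R = R' := by
            rw [← Finset.erase_insert (hnot R x hp.2.2), h1,
              Finset.erase_insert (hnot R' x hp'.2.2)]
          rw [this]
    _ = ∑ Q ∈ S.powersetCard (r + 1),
          (Q.filter fun x => π x ∈ V (W ∪ (Q.erase x).image π)).card := Finset.card_sigma _ _
    _ ≤ ∑ _Q ∈ S.powersetCard (r + 1), δ :=
        Finset.sum_le_sum fun Q _ => card_extreme_le hV hδ π W Q
    _ = δ * S.card.choose (r + 1) := by simp [mul_comm]

/-- Markov's inequality on top of the sampling lemma: if `2 δ |S| ≤ b (r + 1)`, then at most half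
of the samples of size `r` are violated by `b` copies or more. -/
theorem two_mul_card_bad_le (hV : IsViolatorSpace V) {δ : ℕ}
    (hδ : ∀ B, IsBasis V B → B.card ≤ δ) {β : Type*} [DecidableEq β] (S : Finset β) (π : β → H)
    (W : Finset H) (r : ℕ) {b : ℝ} (hb : 0 < b) (hbr : 2 * δ * S.card ≤ b * (r + 1))
    (bad : Finset β → Prop) [DecidablePred bad]
    (hbad : ∀ R, bad R → b ≤ (S.filter fun x => π x ∈ V (W ∪ R.image π)).card) :
    2 * ((S.powersetCard r).filter bad).card ≤ (S.powersetCard r).card := by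
  have h1 : (((S.powersetCard r).filter bad).card : ℝ) * b ≤ δ * S.card.choose (r + 1) := by
    calc (((S.powersetCard r).filter bad).card : ℝ) * b
        = ∑ R ∈ (S.powersetCard r).filter bad, b := by simp
      _ ≤ ∑ R ∈ (S.powersetCard r).filter bad,
            ((S.filter fun x => π x ∈ V (W ∪ R.image π)).card : ℝ) :=
          Finset.sum_le_sum fun R hR => hbad R (Finset.mem_filter.1 hR).2
      _ ≤ ∑ R ∈ S.powersetCard r, ((S.filter fun x => π x ∈ V (W ∪ R.image π)).card : ℝ) :=
          Finset.sum_le_sum_of_subset_of_nonneg (Finset.filter_subset _ _)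
            fun _ _ _ => Nat.cast_nonneg _
      _ ≤ δ * S.card.choose (r + 1) := by
          exact_mod_cast sum_card_violators_le hV hδ S π W r
  have h2 : (S.card.choose (r + 1) : ℝ) * (r + 1) ≤ S.card.choose r * S.card := by
    have : S.card.choose (r + 1) * (r + 1) ≤ S.card.choose r * S.card := by
      rw [Nat.choose_succ_right_eq]
      exact Nat.mul_le_mul_left _ (Nat.sub_le _ _)
    exact_mod_cast this
  rw [Finset.card_powersetCard]
  set x : ℝ := (((S.powersetCard r).filter bad).card : ℝ) with hx
  have hr : (0 : ℝ) < r + 1 := by positivity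
  have h3 : (2 * x) * (b * (r + 1)) ≤ S.card.choose r * (b * (r + 1)) :=
    calc (2 * x) * (b * (r + 1)) = 2 * (r + 1) * (x * b) := by ring
      _ ≤ 2 * (r + 1) * (δ * S.card.choose (r + 1)) := by gcongr
      _ = 2 * δ * (S.card.choose (r + 1) * (r + 1)) := by ring
      _ ≤ 2 * δ * (S.card.choose r * S.card) := by gcongr
      _ = S.card.choose r * (2 * δ * S.card) := by ring
      _ ≤ S.card.choose r * (b * (r + 1)) := by gcongr
  have h4 := le_of_mul_le_mul_right h3 (by positivity)
  rw [hx] at h4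
  exact_mod_cast h4

end ViolatorSpace

/-! ### Expected costs of randomized programs -/

namespace PMF

/-- The expectation of `f` under `p`. -/
noncomputable def expect {α : Type*} (p : PMF α) (f : α → ℝ≥0∞) : ℝ≥0∞ := ∑' x, p x * f x

variable {α β : Type*}

theorem expect_pure (a : α) (f : α → ℝ≥0∞) : (PMF.pure a).expect f = f a := by
  unfold expect
  rw [tsum_eq_single a]
  · simp
  · intro b hb
    simp [hb]

theorem expect_bind (p : PMF α) (k : α → PMF β) (f : β → ℝ≥0∞) :
    (p.bind k).expect f = p.expect fun a => (k a).expect f := by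
  unfold expect
  simp only [PMF.bind_apply, ← ENNReal.tsum_mul_right, ← ENNReal.tsum_mul_left, mul_assoc]
  exact ENNReal.tsum_comm

theorem expect_map (p : PMF α) (k : α → β) (f : β → ℝ≥0∞) :
    (p.map k).expect f = p.expect fun a => f (k a) := by
  unfold PMF.map
  simp only [expect_bind, Function.comp_apply, expect_pure]

theorem expect_mono (p : PMF α) {f g : α → ℝ≥0∞} (h : ∀ a, f a ≤ g a) :
    p.expect f ≤ p.expect g :=
  ENNReal.tsum_le_tsum fun a => mul_le_mul_right (h a) _

theorem expect_add (p : PMF α) (f g : α → ℝ≥0∞) :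
    (p.expect fun a => f a + g a) = p.expect f + p.expect g := by
  unfold expect
  simp only [mul_add, ENNReal.tsum_add]

theorem expect_const (p : PMF α) (c : ℝ≥0∞) : (p.expect fun _ => c) = c := by
  unfold expect
  rw [ENNReal.tsum_mul_right, p.tsum_coe, one_mul]

theorem expect_add_const (p : PMF α) (f : α → ℝ≥0∞) (c : ℝ≥0∞) :
    (p.expect fun a => f a + c) = p.expect f + c := by
  rw [expect_add p f fun _ => c, expect_const]

theorem expect_uniformOfFinset (s : Finset α) (hs : s.Nonempty) (f : α → ℝ≥0∞) :
    (uniformOfFinset s hs).expect f = (s.card : ℝ≥0∞)⁻¹ * ∑ a ∈ s, f a := by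
  classical
  unfold expect
  rw [tsum_eq_sum (s := s), Finset.mul_sum]
  · exact Finset.sum_congr rfl fun a ha => by rw [uniformOfFinset_apply_of_mem _ ha]
  · intro a ha
    rw [uniformOfFinset_apply_of_notMem _ ha, zero_mul]

end PMF

namespace Prog

/-- The expected cost of a random outcome: the number of calls, plus the continuation cost `g a`
of the output `a`, or the penalty `z` if the run was cut off. -/
noncomputable def outcomeCost {α : Type u} (z : ℝ≥0∞) (p : PMF (Option α × ℕ))
    (g : α → ℝ≥0∞) : ℝ≥0∞ :=
  p.expect fun x => x.2 + x.1.elim z g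

theorem outcomeCost_seqOutcome {α β : Type u} (z : ℝ≥0∞) (p : PMF (Option β × ℕ))
    (k : β → PMF (Option α × ℕ)) (g : α → ℝ≥0∞) :
    outcomeCost z (seqOutcome p k) g = outcomeCost z p fun b => outcomeCost z (k b) g := by
  unfold outcomeCost seqOutcome
  rw [PMF.expect_bind]
  congr 1
  funext x
  obtain ⟨o, n⟩ := x
  cases o with
  | none => simp [PMF.expect_pure]
  | some b =>
    simp only [PMF.expect_map, Nat.cast_add, Option.elim_some, add_assoc]
    rw [PMF.expect_add, PMF.expect_const]

theorem outcomeCost_add_le {α : Type u} {z e : ℝ≥0∞} (he : e ≤ z) (p : PMF (Option α × ℕ))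
    {g g' : α → ℝ≥0∞} (h : ∀ a, g a + e ≤ g' a + z) :
    outcomeCost z p g + e ≤ outcomeCost z p g' + z := by
  unfold outcomeCost
  calc _ = p.expect (fun x => x.2 + x.1.elim z g + e) :=
        (PMF.expect_add_const _ _ _).symm
    _ ≤ p.expect (fun x => x.2 + x.1.elim z g' + z) := p.expect_mono fun x => ?_
    _ = _ := PMF.expect_add_const _ _ _
  obtain ⟨o, n⟩ := x
  rw [add_assoc, add_assoc]
  refine add_le_add_right ?_ _
  cases o with
  | none => exact add_le_add_right he _
  | some b => exact h b

theorem outcomeCost_iterOutcome_succ {α σ : Type u} (z : ℝ≥0∞)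
    (f : σ → PMF (Option (σ ⊕ α) × ℕ)) (g : α → ℝ≥0∞) (n : ℕ) (s : σ) :
    outcomeCost z (iterOutcome f (n + 1) s) g =
      outcomeCost z (f s) (Sum.elim (fun s' => outcomeCost z (iterOutcome f n s') g) g) := by
  rw [iterOutcome, outcomeCost_seqOutcome]
  congr 1
  funext r
  rcases r with s' | a
  · rfl
  · simp [outcomeCost, PMF.expect_pure]

/-- Optional stopping for a loop that is charged `c` per round: a potential `Φ` that pays for each
round in expectation bounds the expected total. The penalty `z` is what `t` rounds are charged,
so the initial credit covers a cut-off after `t` rounds. -/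
theorem outcomeCost_iterOutcome_add_le {α σ : Type u} {c z : ℝ≥0∞}
    (f : σ → PMF (Option (σ ⊕ α) × ℕ)) (g : α → ℝ≥0∞) (Φ : σ → ℝ≥0∞)
    (h : ∀ s, c + outcomeCost z (f s) (Sum.elim Φ g) ≤ Φ s) (n : ℕ) (hn : c * n ≤ z) (s : σ) :
    outcomeCost z (iterOutcome f n s) g + c * n ≤ Φ s + z := by
  induction n generalizing s with
  | zero => simp [iterOutcome, outcomeCost, PMF.expect_pure]
  | succ n ih =>
    have hn' : c * n ≤ z := le_trans (by gcongr; simp) hn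
    rw [outcomeCost_iterOutcome_succ]
    calc _ = c + (outcomeCost z (f s)
              (Sum.elim (fun s' => outcomeCost z (iterOutcome f n s') g) g) + c * n) := by
            push_cast; ring
      _ ≤ c + (outcomeCost z (f s) (Sum.elim Φ g) + z) := by
          refine add_le_add_right (outcomeCost_add_le hn' _ ?_) _
          rintro (s' | a)
          · exact ih hn' s'
          · exact add_le_add_right hn' (g a)
      _ ≤ Φ s + z := by
          rw [← add_assoc]
          exact add_le_add_left (h s) _

variable {H : Type u} [DecidableEq H]

/-- The expected cost of a program with cut-off `t`, in a calculus that is charged `c` for each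
round of a loop: the expectation of the number of calls, plus the continuation cost `g a` if the
output is `a`, or the penalty `c * t` if the run is cut off. -/
noncomputable def cost (V : Finset H → Finset H) (t c : ℕ) {α : Type u} (p : Prog H α)
    (g : α → ℝ≥0∞) : ℝ≥0∞ :=
  outcomeCost ((c : ℝ≥0∞) * t) (run V t p) g

variable (V : Finset H → Finset H) (t c : ℕ) {α β σ : Type u}

@[simp]
theorem cost_ret (a : α) (g : α → ℝ≥0∞) : cost V t c (ret a : Prog H α) g = g a := by
  simp [cost, run, outcomeCost, PMF.expect_pure]

theorem cost_query (G : Finset H) (h : H) (k : Bool → Prog H α) (g : α → ℝ≥0∞) :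
    cost V t c (query G h k) g = 1 + cost V t c (k (decide (h ∈ V G))) g := by
  simp only [cost, run, outcomeCost, PMF.expect_map, Nat.cast_add, Nat.cast_one]
  rw [← PMF.expect_const (run V t (k (decide (h ∈ V G)))) 1, ← PMF.expect_add]
  simp only [PMF.expect_const]
  congr 1
  funext x
  ring

@[simp]
theorem cost_bind (p : Prog H β) (k : β → Prog H α) (g : α → ℝ≥0∞) :
    cost V t c (bind p k) g = cost V t c p fun b => cost V t c (k b) g := by
  simp only [cost, run, outcomeCost_seqOutcome]

/-- A uniform draw that is good with probability at least `1/2`, and costs `2 D` less when good. -/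
theorem cost_choose_le {s : Finset β} (hs : s.Nonempty) (k : β → Prog H α) (g : α → ℝ≥0∞)
    (A D : ℝ≥0∞) (bad : β → Prop) [DecidablePred bad] (hbad : 2 * (s.filter bad).card ≤ s.card)
    (h : ∀ b ∈ s, cost V t c (k b) g ≤ A + if bad b then 2 * D else 0) :
    cost V t c (choose s k) g ≤ A + D := by
  have hcard : (s.card : ℝ≥0∞) ≠ 0 := by simpa using hs.ne_empty
  have hcost : cost V t c (choose s k) g =
      (s.card : ℝ≥0∞)⁻¹ * ∑ b ∈ s, cost V t c (k b) g := by
    rw [← PMF.expect_uniformOfFinset s hs]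
    simp only [cost, run, hs, dif_pos, outcomeCost, PMF.expect_bind]
  calc cost V t c (choose s k) g = (s.card : ℝ≥0∞)⁻¹ * ∑ b ∈ s, cost V t c (k b) g := hcost
    _ ≤ (s.card : ℝ≥0∞)⁻¹ * ∑ b ∈ s, (A + if bad b then 2 * D else 0) := by
        gcongr with b hb
        exact h b hb
    _ = (s.card : ℝ≥0∞)⁻¹ * (s.card * A + ((2 * (s.filter bad).card : ℕ) : ℝ≥0∞) * D) := by
        rw [Finset.sum_add_distrib, ← Finset.sum_filter]
        simp only [Finset.sum_const, nsmul_eq_mul]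
        push_cast
        ring_nf
    _ ≤ (s.card : ℝ≥0∞)⁻¹ * (s.card * A + s.card * D) := by gcongr
    _ = A + D := by
        rw [← mul_add, ← mul_assoc, ENNReal.inv_mul_cancel hcard (ENNReal.natCast_ne_top _),
          one_mul]

theorem cost_loop_le (body : σ → Prog H (σ ⊕ α)) (g : α → ℝ≥0∞) (Φ : σ → ℝ≥0∞)
    (h : ∀ s, c + cost V t c (body s) (Sum.elim Φ g) ≤ Φ s) (s : σ) :
    cost V t c (loop body s) g ≤ Φ s := by
  have := outcomeCost_iterOutcome_add_le (fun s => run V t (body s)) g Φ h t le_rfl s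
  have hfin : (c : ℝ≥0∞) * t ≠ ⊤ := by finiteness
  exact (ENNReal.add_le_add_iff_right hfin).1 (by simpa only [cost, run] using this)

theorem expectedCalls_le {p : Prog H α} {g : α → ℝ≥0∞} {K : ℝ≥0∞}
    (h : ∀ t, cost V t 0 p g ≤ K) : expectedCalls V p ≤ K :=
  iSup_le fun t => le_trans (PMF.expect_mono _ fun _ => le_self_add) (h t)

/-- If the program, charged for its loop rounds and infinitely much for outputs outside `S`, has a
finite cost that does not depend on the cut-off `t`, then it halts in `S` almost surely: the
penalty `t` for a cut-off makes the probability of a cut-off at most `K / t`. -/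
theorem outputProb_eq_one {p : Prog H α} {S : Set α} [DecidablePred (· ∈ S)] {K : ℝ≥0∞}
    (hK : K ≠ ⊤) (h : ∀ t, cost V t 1 p (fun a => if a ∈ S then 0 else ⊤) ≤ K) :
    outputProb V p S = 1 := by
  have hle : ∀ t, (run V t p).toOuterMeasure {x | ∃ a ∈ S, x.1 = some a} ≤ 1 := fun t => by
    rw [PMF.toOuterMeasure_apply, ← (run V t p).tsum_coe]
    exact ENNReal.tsum_le_tsum fun x => Set.indicator_le_self _ _ x
  refine le_antisymm (iSup_le hle) ?_
  have key : ∀ t : ℕ, t ≠ 0 →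
      1 ≤ (run V t p).toOuterMeasure {x | ∃ a ∈ S, x.1 = some a} + K / t := by
    intro t ht
    rw [PMF.toOuterMeasure_apply]
    have ht0 : (t : ℝ≥0∞) ≠ 0 := by exact_mod_cast ht
    have h1 : (run V t p).expect (fun x => (x.1.elim ((1 : ℕ) * (t : ℝ≥0∞))
        (fun a => if a ∈ S then 0 else ⊤)) / t) ≤ K / t := by
      have h2 : (run V t p).expect (fun x => (x.1.elim ((1 : ℕ) * (t : ℝ≥0∞))
        (fun a => if a ∈ S then 0 else ⊤))) ≤ K :=
        le_trans (PMF.expect_mono _ fun _ => le_add_self) (h t)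
      simp only [PMF.expect, div_eq_mul_inv] at h2 ⊢
      simp only [← mul_assoc, ENNReal.tsum_mul_right]
      gcongr
    refine le_trans ?_ (add_le_add_right h1 _)
    rw [← (run V t p).tsum_coe]
    unfold PMF.expect
    rw [← ENNReal.tsum_add]
    refine ENNReal.tsum_le_tsum fun x => ?_
    obtain ⟨o, n⟩ := x
    cases o with
    | none =>
      simp only [Nat.cast_one, one_mul, Option.elim_none,
        ENNReal.div_self ht0 (ENNReal.natCast_ne_top t), mul_one]
      exact le_add_self
    | some a =>
      by_cases ha : a ∈ S
      · refine le_trans (le_of_eq ?_) le_self_add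
        rw [Set.indicator_of_mem]
        exact ⟨a, ha, rfl⟩
      · refine le_trans ?_ le_add_self
        by_cases h0 : run V t p (some a, n) = 0
        · simp [h0]
        · simp [ha, ENNReal.top_div, ENNReal.mul_top h0]
  have hlim : Filter.Tendsto (fun t : ℕ => outputProb V p S + K / t) Filter.atTop
      (nhds (outputProb V p S + 0)) := by
    refine Filter.Tendsto.add tendsto_const_nhds ?_
    simp only [div_eq_mul_inv]
    simpa using ENNReal.Tendsto.const_mul ENNReal.tendsto_inv_nat_nhds_zero (Or.inr hK)
  rw [add_zero] at hlim
  refine ge_of_tendsto hlim ?_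
  filter_upwards [Filter.eventually_ne_atTop 0] with t ht
  exact (key t ht).trans (add_le_add_left (le_iSup (fun t =>
    (run V t p).toOuterMeasure {x | ∃ a ∈ S, x.1 = some a}) t) _)

end Prog

/-! ### The trivial algorithm and the violation scan -/

namespace Clarkson

open Prog

variable {H : Type u} [DecidableEq H] {V : Finset H → Finset H} (t c : ℕ)

theorem cost_violators (V : Finset H → Finset H) (C : Finset H) (L : List H)
    (g : Finset H → ℝ≥0∞) :
    cost V t c (violators C L) g = L.length + g (L.toFinset.filter (· ∈ V C)) := by
  induction L generalizing g with
  | nil => simp [violators]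
  | cons h L ih =>
    simp only [violators, cost_query, cost_bind, cost_ret, ih, List.toFinset_cons,
      Finset.filter_insert, decide_eq_true_eq, List.length_cons, Nat.cast_add, Nat.cast_one]
    ring

theorem cost_violators_sdiff_le (hV : IsViolatorSpace V) (C G : Finset H)
    (g : Finset H → ℝ≥0∞) :
    cost V t c (violators C (G \ C).toList) g ≤ G.card + g (G.filter (· ∈ V C)) := by
  have h : (G \ C).filter (· ∈ V C) = G.filter (· ∈ V C) := by
    ext x
    simp only [Finset.mem_filter, Finset.mem_sdiff]
    exact ⟨fun hx => ⟨hx.1.1, hx.2⟩, fun hx => ⟨⟨hx.1, hV.notMem_of_mem hx.2⟩, hx.2⟩⟩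
  rw [cost_violators, Finset.toList_toFinset, h, Finset.length_toList]
  gcongr
  exact Finset.sdiff_subset

theorem cost_checkAll_le (V : Finset H → Finset H) {α : Type u} (yes no : Prog H α)
    (L : List (Finset H × H × Bool)) (g : α → ℝ≥0∞) :
    cost V t c (checkAll yes no L) g ≤
      L.length + if ∀ x ∈ L, decide (x.2.1 ∈ V x.1) = x.2.2 then cost V t c yes g
        else cost V t c no g := by
  induction L with
  | nil => simp [checkAll]
  | cons x L ih =>
    obtain ⟨F, h, b⟩ := x
    rw [checkAll, cost_query, List.length_cons, Nat.cast_add, Nat.cast_one, add_comm (_ : ℝ≥0∞) 1,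
      add_assoc]
    refine add_le_add_right ?_ _
    by_cases hb : decide (h ∈ V F) = b
    · simpa only [hb, if_true, List.forall_mem_cons, true_and] using ih
    · simp only [hb, if_false, List.forall_mem_cons, false_and]
      exact le_add_self

theorem length_basisTests {G B : Finset H} (hBG : B ⊆ G) : (basisTests G B).length = G.card := by
  simp only [basisTests, List.length_append, List.length_map, Finset.length_toList]
  rw [add_comm, Finset.card_sdiff_add_card_eq_card hBG]

theorem basisTests_succeed_iff (hV : IsViolatorSpace V) {G B : Finset H} (hBG : B ⊆ G) :
    (∀ x ∈ basisTests G B, decide (x.2.1 ∈ V x.1) = x.2.2) ↔ IsBasisOf V B G := by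
  rw [isBasisOf_iff_tests hV hBG]
  simp only [basisTests, List.mem_append, List.mem_map, Finset.mem_toList]
  constructor
  · exact fun h => ⟨fun x hx => by simpa using h _ (Or.inl ⟨x, hx, rfl⟩),
      fun x hx => by simpa using h _ (Or.inr ⟨x, hx, rfl⟩)⟩
  · rintro ⟨h1, h2⟩ _ (⟨x, hx, rfl⟩ | ⟨x, hx, rfl⟩)
    · simpa using h1 x hx
    · simpa using h2 x hx

theorem cost_firstBasis_le (hV : IsViolatorSpace V) {G : Finset H} {g : Finset H → ℝ≥0∞}
    {M : ℝ≥0∞} (hg : ∀ B, IsBasisOf V B G → g B ≤ M) (L : List (Finset H))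
    (hL : ∀ B ∈ L, B ⊆ G) (hex : ∃ B ∈ L, IsBasisOf V B G) :
    cost V t c (firstBasis G L) g ≤ (L.length * G.card : ℕ) + M := by
  induction L with
  | nil => simp at hex
  | cons B L ih =>
    have hBG : B ⊆ G := hL B (by simp)
    have h1 : ((((B :: L).length * G.card : ℕ)) : ℝ≥0∞) + M =
        G.card + ((L.length * G.card : ℕ) + M) := by
      rw [List.length_cons]
      push_cast
      ring
    rw [h1, firstBasis]
    refine (cost_checkAll_le t c V _ _ _ _).trans ?_
    rw [length_basisTests hBG]
    refine add_le_add_right ?_ _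
    by_cases hB : IsBasisOf V B G
    · rw [if_pos ((basisTests_succeed_iff hV hBG).2 hB), cost_ret]
      exact (hg B hB).trans le_add_self
    · rw [if_neg (mt (basisTests_succeed_iff hV hBG).1 hB)]
      refine ih (fun B' hB' => hL B' (by simp [hB'])) ?_
      obtain ⟨B', hB', hB''⟩ := hex
      rcases List.mem_cons.1 hB' with rfl | hB'
      · exact absurd hB'' hB
      · exact ⟨B', hB', hB''⟩

theorem card_powerset_filter_card_le (G : Finset H) (δ : ℕ) :
    (G.powerset.filter fun B => B.card ≤ δ).card ≤ (G.card + 1) ^ δ := by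
  have h1 : G.powerset.filter (fun B => B.card ≤ δ) ⊆
      (Finset.range (δ + 1)).biUnion fun k => G.powersetCard k := by
    intro B hB
    simp only [Finset.mem_filter, Finset.mem_powerset] at hB
    simp only [Finset.mem_biUnion, Finset.mem_range, Finset.mem_powersetCard]
    exact ⟨B.card, by omega, hB.1, rfl⟩
  calc _ ≤ _ := Finset.card_le_card h1
    _ ≤ ∑ k ∈ Finset.range (δ + 1), (G.powersetCard k).card := Finset.card_biUnion_le
    _ ≤ ∑ k ∈ Finset.range (δ + 1), G.card ^ k * 1 ^ (δ - k) * δ.choose k := by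
        refine Finset.sum_le_sum fun k hk => ?_
        rw [Finset.card_powersetCard, one_pow, mul_one]
        exact (Nat.choose_le_pow _ _).trans (Nat.le_mul_of_pos_right _
          (Nat.choose_pos (by simpa [Nat.lt_succ_iff] using hk)))
    _ = (G.card + 1) ^ δ := by rw [add_pow]; rfl

/-- A bound for the number of calls made by the trivial algorithm on at most `6 δ²` elements. -/
def trivialBound (δ : ℕ) : ℕ := (6 * δ ^ 2 + 1) ^ δ * (6 * δ ^ 2)

theorem cost_trivialAlg_le (hV : IsViolatorSpace V) {δ : ℕ}
    (hδ : ∀ B, IsBasis V B → B.card ≤ δ) {G : Finset H} (hG : G.card ≤ 6 * δ ^ 2)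
    {g : Finset H → ℝ≥0∞} {M : ℝ≥0∞} (hg : ∀ B, IsBasisOf V B G → g B ≤ M) :
    cost V t c (trivialAlg δ G) g ≤ trivialBound δ + M := by
  refine (cost_firstBasis_le t c hV hg _ ?_ ?_).trans ?_
  · intro B hB
    simp only [Finset.mem_toList, Finset.mem_filter, Finset.mem_powerset] at hB
    exact hB.1
  · obtain ⟨B, hB⟩ := exists_isBasisOf V G
    refine ⟨B, ?_, hB⟩
    simp only [Finset.mem_toList, Finset.mem_filter, Finset.mem_powerset]
    exact ⟨hB.1.1, hδ B (hB.isBasis hV)⟩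
  · refine add_le_add_left ?_ _
    rw [Finset.length_toList]
    have := card_powerset_filter_card_le G δ
    unfold trivialBound
    exact_mod_cast Nat.mul_le_mul (this.trans (by gcongr)) hG

/-! ### The reweighting algorithm -/

theorem sum_reweight {G X : Finset H} (hX : X ⊆ G) (μ : H → ℕ) :
    ∑ h ∈ G, (if h ∈ X then 2 * μ h else μ h) = ∑ h ∈ G, μ h + ∑ h ∈ X, μ h := by
  rw [← Finset.sum_sdiff hX, ← Finset.sum_sdiff hX (f := μ), add_assoc, ← two_mul, Finset.mul_sum]
  congr 1
  · exact Finset.sum_congr rfl fun h hh => by simp [(Finset.mem_sdiff.1 hh).2]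
  · exact Finset.sum_congr rfl fun h hh => by simp [hh]

/-- The potential of the multiplicities `μ`: the total multiplicity grows slowly, while the
multiplicities on a fixed basis `B`, which cannot exceed the total one, are doubled one by one. -/
noncomputable def potential (δ : ℕ) (G B : Finset H) (μ : H → ℕ) : ℝ :=
  4 * (δ * Real.logb 2 (∑ h ∈ G, μ h : ℕ) - ∑ h ∈ B, Real.logb 2 (μ h))

omit [DecidableEq H] in
theorem potential_nonneg {δ : ℕ} {G B : Finset H} (hBG : B ⊆ G) (hBδ : B.card ≤ δ) {μ : H → ℕ}
    (hμ : ∀ h, 1 ≤ μ h) : 0 ≤ potential δ G B μ := by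
  have hlog : ∀ h ∈ B, Real.logb 2 (μ h) ≤ Real.logb 2 (∑ h ∈ G, μ h : ℕ) := fun h hh => by
    refine Real.logb_le_logb_of_le (by norm_num) (by exact_mod_cast hμ h) ?_
    exact_mod_cast Finset.single_le_sum (f := μ) (fun _ _ => Nat.zero_le _) (hBG hh)
  have hnn : 0 ≤ Real.logb 2 (∑ h ∈ G, μ h : ℕ) := by
    rcases Nat.eq_zero_or_pos (∑ h ∈ G, μ h) with h0 | h0
    · simp [h0]
    · exact Real.logb_nonneg (by norm_num) (by exact_mod_cast h0)
  have h1 : ∑ h ∈ B, Real.logb 2 (μ h) ≤ δ * Real.logb 2 (∑ h ∈ G, μ h : ℕ) :=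
    calc ∑ h ∈ B, Real.logb 2 (μ h) ≤ ∑ _h ∈ B, Real.logb 2 (∑ h ∈ G, μ h : ℕ) :=
          Finset.sum_le_sum hlog
      _ = B.card * Real.logb 2 (∑ h ∈ G, μ h : ℕ) := by simp
      _ ≤ δ * Real.logb 2 (∑ h ∈ G, μ h : ℕ) := by gcongr
  unfold potential
  linarith

/-- A successful reweighting multiplies the total by at most `1 + 1 / (3 δ)`, which raises
`δ log₂` of it by at most `1 / (3 log 2) ≤ 1 / 2`, and doubles the multiplicity of an element of
`B`. -/
theorem potential_reweight_add_two_le {δ : ℕ} (hδ : 1 ≤ δ) {G B X : Finset H} (hX : X ⊆ G)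
    {μ : H → ℕ} (hμ : ∀ h, 1 ≤ μ h) (hlight : 3 * δ * ∑ h ∈ X, μ h ≤ ∑ h ∈ G, μ h)
    (hXB : ∃ h ∈ B, h ∈ X) :
    potential δ G B (fun h => if h ∈ X then 2 * μ h else μ h) + 2 ≤ potential δ G B μ := by
  obtain ⟨b, hbB, hbX⟩ := hXB
  have hδ' : (1 : ℝ) ≤ δ := by exact_mod_cast hδ
  have hm : 0 < ∑ h ∈ G, μ h :=
    lt_of_lt_of_le (hμ b) (Finset.single_le_sum (f := μ) (fun _ _ => Nat.zero_le _) (hX hbX))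
  have hm' : (0 : ℝ) < (∑ h ∈ G, μ h : ℕ) := by exact_mod_cast hm
  have hlogB : ∑ h ∈ B, Real.logb 2 (μ h) + 1 ≤
      ∑ h ∈ B, Real.logb 2 ((if h ∈ X then 2 * μ h else μ h : ℕ)) := by
    have h1 : ∀ h ∈ B, Real.logb 2 (μ h) + (if h = b then 1 else 0) ≤
        Real.logb 2 ((if h ∈ X then 2 * μ h else μ h : ℕ)) := by
      intro h _
      have h0 : (μ h : ℝ) ≠ 0 := by exact_mod_cast (Nat.one_le_iff_ne_zero.1 (hμ h))
      by_cases hhX : h ∈ X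
      · have : Real.logb 2 ((2 * μ h : ℕ)) = Real.logb 2 (μ h) + 1 := by
          push_cast
          rw [Real.logb_mul (by norm_num) h0, Real.logb_self_eq_one (by norm_num), add_comm]
        simp only [hhX, if_true, this]
        split_ifs <;> linarith
      · have : h ≠ b := fun hb => hhX (hb ▸ hbX)
        simp [hhX, this]
    calc _ = ∑ h ∈ B, (Real.logb 2 (μ h) + (if h = b then 1 else 0)) := by
          rw [Finset.sum_add_distrib]
          simp [hbB]
      _ ≤ _ := Finset.sum_le_sum h1
  have hlogG : δ * Real.logb 2 (∑ h ∈ G, (if h ∈ X then 2 * μ h else μ h) : ℕ) ≤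
      δ * Real.logb 2 (∑ h ∈ G, μ h : ℕ) + 1 / 2 := by
    rw [sum_reweight hX]
    set m : ℝ := ((∑ h ∈ G, μ h : ℕ) : ℝ) with hmdef
    have hx : (((∑ h ∈ G, μ h + ∑ h ∈ X, μ h : ℕ)) : ℝ) ≤ m * (1 + 1 / (3 * δ)) := by
      have h3 : 3 * (δ : ℝ) * ((∑ h ∈ X, μ h : ℕ) : ℝ) ≤ m := by
        rw [hmdef]
        exact_mod_cast hlight
      rw [Nat.cast_add, mul_add, mul_one, mul_one_div]
      refine add_le_add_right ?_ _
      rw [le_div_iff₀ (by positivity)]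
      linarith
    have hpos : (0 : ℝ) < ((∑ h ∈ G, μ h + ∑ h ∈ X, μ h : ℕ) : ℝ) := by
      exact_mod_cast Nat.add_pos_left hm _
    have h4 := Real.logb_le_logb_of_le (b := 2) (by norm_num) hpos hx
    have h5 : Real.logb 2 (1 + 1 / (3 * δ)) ≤ 1 / (2 * δ) := by
      rw [Real.logb, div_le_iff₀ (Real.log_pos (by norm_num))]
      have h6 := Real.log_le_sub_one_of_pos (x := 1 + 1 / (3 * (δ : ℝ))) (by positivity)
      have h7 := Real.log_two_gt_d9
      have h8 : 1 / (2 * (δ : ℝ)) * (2 / 3) ≤ 1 / (2 * δ) * Real.log 2 := by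
        gcongr
        linarith
      have h9 : 1 / (2 * (δ : ℝ)) * (2 / 3) = 1 / (3 * δ) := by field_simp
      linarith
    rw [Real.logb_mul hm'.ne' (by positivity)] at h4
    calc _ ≤ δ * (Real.logb 2 m + 1 / (2 * δ)) := by gcongr; linarith
      _ = δ * Real.logb 2 m + 1 / 2 := by field_simp
  unfold potential
  linarith

/-- A bound for the expected cost of the reweighting algorithm on `m` elements, where each round
of its loop is charged `c` on top of its calls. -/
noncomputable def basis2Bound (δ c m : ℕ) : ℝ≥0∞ :=
  ((c + trivialBound δ + m : ℕ) : ℝ≥0∞) * (ENNReal.ofReal (4 * (δ * Real.logb 2 m)) + 2)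

omit [DecidableEq H] in
theorem card_copies (G : Finset H) (μ : H → ℕ) : (copies G μ).card = ∑ h ∈ G, μ h := by
  simp [copies, Finset.card_sigma]

omit [DecidableEq H] in
theorem card_filter_copies (G : Finset H) (μ : H → ℕ) (p : H → Prop) [DecidablePred p] :
    ((copies G μ).filter fun x => p x.1).card = ∑ h ∈ G.filter p, μ h := by
  rw [← card_copies]
  congr 1
  ext x
  simp only [copies, Finset.mem_filter, Finset.mem_sigma, Finset.mem_range]
  tauto

/-- A round costs `D = c + trivialBound δ + |G|` at most, and with probability at least `1/2` it
ends the loop or lowers `potential` by `2`; so `D * (potential + 2)` pays for the loop. The total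
multiplicity of the violators of the random sample has expectation at most
`(∑_{h ∈ G} μ h) / (6 δ)`, half of the threshold for success. -/
theorem cost_basis2_le (hV : IsViolatorSpace V) {δ : ℕ} (hδ1 : 1 ≤ δ)
    (hδ : ∀ B, IsBasis V B → B.card ≤ δ) {G : Finset H}
    {g : Finset H → ℝ≥0∞} {M : ℝ≥0∞} (hg : ∀ B, IsBasisOf V B G → g B ≤ M) :
    cost V t c (basis2 δ G) g ≤ basis2Bound δ c G.card + M := by
  classical
  set D : ℝ≥0∞ := ((c + trivialBound δ + G.card : ℕ) : ℝ≥0∞) with hD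
  unfold basis2
  split_ifs with hG
  · refine (cost_trivialAlg_le t c hV hδ hG hg).trans (add_le_add_left ?_ _)
    calc (trivialBound δ : ℝ≥0∞) ≤ D * 1 := by
          rw [mul_one, hD]
          exact_mod_cast (by omega)
      _ ≤ basis2Bound δ c G.card := by
          unfold basis2Bound
          gcongr
          exact le_trans (by norm_num) le_add_self
  obtain ⟨B, hB⟩ := exists_isBasisOf V G
  have hBδ := hδ B (hB.isBasis hV)
  -- The potential is infinite off the invariant, where nothing has to be shown.
  set Φ : (H → ℕ) → ℝ≥0∞ := fun μ =>
    if ∀ h, 1 ≤ μ h then M + D * ENNReal.ofReal (potential δ G B μ) + 2 * D else ⊤ with hΦ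
  have hstep := cost_loop_le V t c (fun μ : H → ℕ =>
        Prog.choose ((copies G μ).powersetCard (6 * δ ^ 2)) fun R =>
        Prog.bind (trivialAlg δ (R.image Sigma.fst)) fun C =>
        Prog.bind (violators C (G \ C).toList) fun X =>
        Prog.ret
          (if X = ∅ then Sum.inr C
          else if 3 * δ * ∑ h ∈ X, μ h ≤ ∑ h ∈ G, μ h then
            Sum.inl fun h => if h ∈ X then 2 * μ h else μ h
          else Sum.inl μ)) g Φ ?_ (fun _ => 1)
  · refine hstep.trans (le_of_eq ?_)
    rw [hΦ]
    simp only [le_refl, implies_true, if_true, potential, basis2Bound, Nat.cast_one,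
      Real.logb_one, Finset.sum_const_zero, sub_zero, Finset.sum_const, smul_eq_mul, mul_one]
    rw [← hD]
    ring
  intro μ
  by_cases hμ : ∀ h, 1 ≤ μ h
  swap
  · rw [hΦ]
    simp only [hμ, if_false, le_top]
  have hm : G.card ≤ ∑ h ∈ G, μ h := by
    simpa using Finset.card_nsmul_le_sum G μ 1 fun h _ => hμ h
  set A : ℝ≥0∞ := M + D * ENNReal.ofReal (potential δ G B μ) with hA
  have hΦμ : Φ μ = A + 2 * D := by
    rw [hΦ]
    simp only [hμ, implies_true, if_true, hA]
  set bad : Finset (Σ _ : H, ℕ) → Prop := fun R =>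
    ¬ 3 * δ * ∑ h ∈ G.filter (· ∈ V (R.image Sigma.fst)), μ h ≤ ∑ h ∈ G, μ h with hbad
  have hne : ((copies G μ).powersetCard (6 * δ ^ 2)).Nonempty := by
    rw [Finset.powersetCard_nonempty, card_copies]
    omega
  have hhalf : 2 * (((copies G μ).powersetCard (6 * δ ^ 2)).filter bad).card ≤
      ((copies G μ).powersetCard (6 * δ ^ 2)).card := by
    have hδ' : (1 : ℝ) ≤ δ := by exact_mod_cast hδ1
    have hmpos : (0 : ℝ) < (∑ h ∈ G, μ h : ℕ) := by
      have : 0 < ∑ h ∈ G, μ h := by omega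
      exact_mod_cast this
    refine two_mul_card_bad_le hV hδ (copies G μ) Sigma.fst ∅ (6 * δ ^ 2)
      (b := (∑ h ∈ G, μ h : ℕ) / (3 * δ)) (by positivity) ?_ bad ?_
    · rw [card_copies, div_mul_eq_mul_div, le_div_iff₀ (by positivity)]
      push_cast at hmpos ⊢
      linarith
    · intro R hR
      rw [hbad] at hR
      simp only [Finset.empty_union]
      rw [card_filter_copies G μ (· ∈ V (R.image Sigma.fst)), div_le_iff₀ (by positivity)]
      push Not at hR
      have hR' : ((∑ h ∈ G, μ h : ℕ) : ℝ) ≤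
          (3 * δ * ∑ h ∈ G.filter (· ∈ V (R.image Sigma.fst)), μ h : ℕ) := by
        exact_mod_cast hR.le
      refine hR'.trans (le_of_eq ?_)
      push_cast
      ring
  have hround : ∀ R ∈ (copies G μ).powersetCard (6 * δ ^ 2),
      cost V t c (Prog.bind (trivialAlg δ (R.image Sigma.fst)) fun C =>
        Prog.bind (violators C (G \ C).toList) fun X =>
        Prog.ret
          (if X = ∅ then Sum.inr C
          else if 3 * δ * ∑ h ∈ X, μ h ≤ ∑ h ∈ G, μ h then
            Sum.inl fun h => if h ∈ X then 2 * μ h else μ h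
          else Sum.inl μ)) (Sum.elim Φ g) ≤
        (trivialBound δ + G.card + A) + if bad R then 2 * D else 0 := by
    intro R hR
    rw [Finset.mem_powersetCard] at hR
    have hRG : R.image Sigma.fst ⊆ G := by
      intro h hh
      obtain ⟨x, hx, rfl⟩ := Finset.mem_image.1 hh
      exact (Finset.mem_sigma.1 (hR.1 hx)).1
    rw [cost_bind, add_assoc, add_assoc]
    refine cost_trivialAlg_le t c hV hδ (Finset.card_image_le.trans hR.2.le) fun C hC => ?_
    rw [cost_bind]
    refine (cost_violators_sdiff_le t c hV C G _).trans (add_le_add_right ?_ _)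
    have hVC := hC.1.2
    have hCG := hC.1.1.trans hRG
    rw [cost_ret, hVC]
    by_cases hX : G.filter (· ∈ V (R.image Sigma.fst)) = ∅
    · have hCB : V (R.image Sigma.fst) = V G :=
        hB.violators_eq hV hRG fun h hh hhV => by
          have : h ∈ G.filter (· ∈ V (R.image Sigma.fst)) :=
            Finset.mem_filter.2 ⟨hB.1.1 hh, hhV⟩
          simp [hX] at this
      simp only [hX, if_true, Sum.elim_inr]
      exact ((hg C (hC.of_violators_eq hRG hCB)).trans le_self_add).trans le_self_add
    · simp only [hX, if_false]
      by_cases hb : bad R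
      · have hb' := hb
        rw [hbad] at hb'
        simp only [hb', hb, if_false, if_true, Sum.elim_inl]
        exact hΦμ.le
      · have hb' := hb
        rw [hbad] at hb'
        simp only [not_not] at hb'
        simp only [hb', hb, if_true, if_false, add_zero, Sum.elim_inl]
        have hXB : ∃ h ∈ B, h ∈ G.filter (· ∈ V (R.image Sigma.fst)) := by
          by_contra hno
          push Not at hno
          have hCB : V (R.image Sigma.fst) = V G :=
            hB.violators_eq hV hRG fun h hh hhV =>
              hno h hh (Finset.mem_filter.2 ⟨hB.1.1 hh, hhV⟩)
          refine hX (Finset.filter_eq_empty_iff.2 fun h hh hhV => ?_)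
          exact hV.notMem_of_mem (hCB ▸ hhV) hh
        have hμ' : ∀ h, 1 ≤ (fun h => if h ∈ G.filter (· ∈ V (R.image Sigma.fst)) then 2 * μ h
            else μ h) h := fun h => by
          have := hμ h
          dsimp only
          split_ifs <;> omega
        have hpot := potential_reweight_add_two_le hδ1 (Finset.filter_subset _ _) hμ hb' hXB
        have hnn := potential_nonneg hB.1.1 hBδ hμ'
        rw [hΦ]
        simp only [if_pos hμ']
        rw [hA, add_assoc, mul_comm 2 D, ← mul_add]
        gcongr
        calc _ = ENNReal.ofReal (potential δ G B
                (fun h => if h ∈ G.filter (· ∈ V (R.image Sigma.fst)) then 2 * μ h else μ h)) +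
                ENNReal.ofReal 2 := by norm_num
          _ ≤ _ := by
              rw [← ENNReal.ofReal_add hnn (by norm_num)]
              exact ENNReal.ofReal_le_ofReal hpot
  calc _ ≤ c + ((trivialBound δ + G.card + A) + D) := by
        gcongr
        exact cost_choose_le V t c hne _ _ _ D bad hhalf hround
    _ = Φ μ := by
        rw [hΦμ, hD]
        push_cast
        ring

/-! ### The working set algorithm -/

theorem basis2Bound_mono (δ c : ℕ) {m m' : ℕ} (h : m ≤ m') :
    basis2Bound δ c m ≤ basis2Bound δ c m' := by
  have hlog : Real.logb 2 m ≤ Real.logb 2 m' := by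
    rcases Nat.eq_zero_or_pos m with rfl | hm
    · rcases Nat.eq_zero_or_pos m' with rfl | hm'
      · rfl
      · simpa using Real.logb_nonneg (b := 2) (by norm_num) (by exact_mod_cast hm' : (1 : ℝ) ≤ m')
    · exact Real.logb_le_logb_of_le (by norm_num) (by exact_mod_cast hm) (by exact_mod_cast h)
  unfold basis2Bound
  gcongr

/-- A bound for the expected cost of a round of the working set algorithm on `n` elements, where
each round of a loop is charged `c` on top of its calls: the working set together with the sample
has at most `3 δ √n` elements. -/
noncomputable def roundBound (δ c n : ℕ) : ℝ≥0∞ :=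
  c + (basis2Bound δ c ⌊3 * δ * √(n : ℝ)⌋₊ + n)

/-- A sample of size `⌊δ √n⌋` has at most `√n` violators in expectation, half of the threshold for
success; so `2 D (|B \ W| + 1)` pays for rounds of cost `D`. -/
theorem cost_basis1_loop_le (hV : IsViolatorSpace V) {δ : ℕ} (hδ1 : 1 ≤ δ)
    (hδ : ∀ B, IsBasis V B → B.card ≤ δ) {G : Finset H} (hG : 9 * δ ^ 2 < G.card)
    {g : Finset H → ℝ≥0∞} {M : ℝ≥0∞} (hg : ∀ B, IsBasisOf V B G → g B ≤ M) :
    cost V t c (basis1 δ G) g ≤ M + 2 * roundBound δ c G.card * (δ + 1) := by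
  classical
  set D : ℝ≥0∞ := roundBound δ c G.card with hD
  unfold basis1
  rw [if_neg (by omega)]
  obtain ⟨B, hB⟩ := exists_isBasisOf V G
  have hBδ := hδ B (hB.isBasis hV)
  set s : ℝ := √(G.card : ℝ) with hs
  have hss : s * s = G.card := Real.mul_self_sqrt (Nat.cast_nonneg _)
  have hδ' : (1 : ℝ) ≤ δ := by exact_mod_cast hδ1
  have hG' : 9 * (δ : ℝ) ^ 2 < G.card := by exact_mod_cast hG
  have hs0 : 0 < s := Real.sqrt_pos.2 (by nlinarith)
  have hδs : 3 * (δ : ℝ) ≤ s := by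
    refine Real.le_sqrt_of_sq_le ?_
    nlinarith
  set r : ℕ := ⌊(δ : ℝ) * s⌋₊ with hr
  have hrle : (r : ℝ) ≤ δ * s := Nat.floor_le (by positivity)
  have hrlt : (δ : ℝ) * s < r + 1 := Nat.lt_floor_add_one _
  -- Each successful round adds at most `2 √n` elements to `W`, one of them from `B`.
  set I : Finset H → Prop := fun W => W ⊆ G ∧ (W.card : ℝ) ≤ 2 * s * (B ∩ W).card with hI
  set Φ : Finset H → ℝ≥0∞ := fun W =>
    if I W then M + 2 * D * (B \ W).card + 2 * D else ⊤ with hΦ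
  have hstep := cost_loop_le V t c (fun W : Finset H =>
        Prog.choose (G.powersetCard r) fun R =>
        Prog.bind (basis2 δ (W ∪ R)) fun C =>
        Prog.bind (violators C (G \ C).toList) fun X =>
        Prog.ret
          (if X = ∅ then Sum.inr C
          else if (X.card : ℝ) ≤ 2 * s then Sum.inl (W ∪ X)
          else Sum.inl W)) g Φ ?_ ∅
  · refine hstep.trans ?_
    have hI0 : I ∅ := by simp [hI]
    simp only [hΦ, hI0, if_true, Finset.sdiff_empty]
    rw [mul_add, mul_one, add_assoc]
    gcongr
  intro W
  by_cases hW : I W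
  swap
  · simp only [hΦ, hW, if_false, le_top]
  set A : ℝ≥0∞ := M + 2 * D * (B \ W).card with hA
  have hΦW : Φ W = A + 2 * D := by simp only [hΦ, hW, if_true, hA]
  set bad : Finset H → Prop := fun R =>
    ¬ ((G.filter (· ∈ V (W ∪ R))).card : ℝ) ≤ 2 * s with hbad
  have hne : (G.powersetCard r).Nonempty := by
    rw [Finset.powersetCard_nonempty]
    have : (r : ℝ) ≤ G.card := by nlinarith
    exact_mod_cast this
  have hhalf : 2 * ((G.powersetCard r).filter bad).card ≤ (G.powersetCard r).card := by
    refine two_mul_card_bad_le hV hδ G id W r (b := 2 * s) (by positivity) ?_ bad ?_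
    · rw [← hss]
      nlinarith
    · intro R hR
      rw [hbad] at hR
      push Not at hR
      simpa only [Finset.image_id, id] using hR.le
  have hround : ∀ R ∈ G.powersetCard r,
      cost V t c (Prog.bind (basis2 δ (W ∪ R)) fun C =>
        Prog.bind (violators C (G \ C).toList) fun X =>
        Prog.ret
          (if X = ∅ then Sum.inr C
          else if (X.card : ℝ) ≤ 2 * s then Sum.inl (W ∪ X)
          else Sum.inl W)) (Sum.elim Φ g) ≤
        (basis2Bound δ c ⌊3 * δ * s⌋₊ + G.card + A) + if bad R then 2 * D else 0 := by
    intro R hR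
    rw [Finset.mem_powersetCard] at hR
    have hRG : W ∪ R ⊆ G := Finset.union_subset hW.1 hR.1
    have hcard : (W ∪ R).card ≤ ⌊3 * δ * s⌋₊ := by
      refine Nat.le_floor ?_
      have h1 : ((W ∪ R).card : ℝ) ≤ W.card + R.card := by
        exact_mod_cast Finset.card_union_le _ _
      have h2 : ((B ∩ W).card : ℝ) ≤ δ := by
        exact_mod_cast (Finset.card_le_card Finset.inter_subset_left).trans hBδ
      have h3 : 2 * s * ((B ∩ W).card : ℝ) ≤ 2 * s * δ := by gcongr
      rw [hR.2] at h1
      linarith [hW.2]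
    rw [cost_bind, add_assoc, add_assoc]
    refine le_trans ?_ (add_le_add_left (basis2Bound_mono δ c hcard) _)
    refine cost_basis2_le t c hV hδ1 hδ fun C hC => ?_
    rw [cost_bind]
    refine (cost_violators_sdiff_le t c hV C G _).trans (add_le_add_right ?_ _)
    rw [cost_ret, hC.1.2]
    by_cases hX : G.filter (· ∈ V (W ∪ R)) = ∅
    · have hCB : V (W ∪ R) = V G :=
        hB.violators_eq hV hRG fun h hh hhV => by
          have : h ∈ G.filter (· ∈ V (W ∪ R)) :=
            Finset.mem_filter.2 ⟨hB.1.1 hh, hhV⟩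
          simp [hX] at this
      simp only [hX, if_true, Sum.elim_inr]
      exact ((hg C (hC.of_violators_eq hRG hCB)).trans le_self_add).trans le_self_add
    · simp only [hX, if_false]
      by_cases hb : bad R
      · have hb' := hb
        rw [hbad] at hb'
        simp only [hb', hb, if_false, if_true, Sum.elim_inl]
        exact hΦW.le
      · have hb' := hb
        rw [hbad] at hb'
        simp only [not_not] at hb'
        simp only [hb', hb, if_true, if_false, add_zero, Sum.elim_inl]
        set X := G.filter (· ∈ V (W ∪ R)) with hXdef
        obtain ⟨b, hbB, hbX⟩ : ∃ h ∈ B, h ∈ X := by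
          by_contra hno
          push Not at hno
          have hCB : V (W ∪ R) = V G :=
            hB.violators_eq hV hRG fun h hh hhV =>
              hno h hh (Finset.mem_filter.2 ⟨hB.1.1 hh, hhV⟩)
          refine hX (Finset.filter_eq_empty_iff.2 fun h hh hhV => ?_)
          exact hV.notMem_of_mem (hCB ▸ hhV) hh
        have hbW : b ∉ W := fun hbW =>
          hV.notMem_of_mem (Finset.mem_filter.1 hbX).2 (Finset.mem_union_left _ hbW)
        have hinter : (B ∩ W).card + 1 ≤ (B ∩ (W ∪ X)).card := by
          rw [← Finset.card_insert_of_notMem (a := b) (s := B ∩ W) (by simp [hbW])]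
          refine Finset.card_le_card (Finset.insert_subset ?_ ?_)
          · simp [hbB, hbX]
          · exact Finset.inter_subset_inter_left Finset.subset_union_left
        have hsd : (B \ (W ∪ X)).card + 1 ≤ (B \ W).card := by
          rw [← Finset.card_insert_of_notMem (a := b) (s := B \ (W ∪ X)) (by simp [hbX])]
          refine Finset.card_le_card (Finset.insert_subset ?_ ?_)
          · simp [hbB, hbW]
          · exact Finset.sdiff_subset_sdiff subset_rfl Finset.subset_union_left
        have hI' : I (W ∪ X) := by
          refine ⟨Finset.union_subset hW.1 (Finset.filter_subset _ _), ?_⟩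
          have h1 : ((W ∪ X).card : ℝ) ≤ W.card + X.card := by
            exact_mod_cast Finset.card_union_le _ _
          have h2 : ((B ∩ W).card : ℝ) + 1 ≤ (B ∩ (W ∪ X)).card := by exact_mod_cast hinter
          have h3 : 2 * s * (((B ∩ W).card : ℝ) + 1) ≤ 2 * s * (B ∩ (W ∪ X)).card := by gcongr
          linarith [hW.2]
        simp only [hΦ, hI', if_true]
        rw [hA, add_assoc]
        refine add_le_add_right ?_ _
        have h4 : (((B \ (W ∪ X)).card : ℝ≥0∞) + 1) ≤ (B \ W).card := by exact_mod_cast hsd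
        calc _ = 2 * D * (((B \ (W ∪ X)).card : ℝ≥0∞) + 1) := by ring
          _ ≤ _ := by gcongr
  calc _ ≤ c + ((basis2Bound δ c ⌊3 * δ * s⌋₊ + G.card + A) + D) := by
        gcongr
        exact cost_choose_le V t c hne _ _ _ D bad hhalf hround
    _ = Φ W := by
        rw [hΦW, hD, roundBound, ← hs]
        ring

/-- In dimension `0` the empty set is a basis of everything, and the first round ends the loop. -/
theorem cost_basis1_zero_le (hV : IsViolatorSpace V) (hδ : ∀ B, IsBasis V B → B.card ≤ 0)
    (G : Finset H) {g : Finset H → ℝ≥0∞} (hg : ∀ B, IsBasisOf V B G → g B ≤ 0) :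
    cost V t c (basis1 0 G) g ≤ (c + G.card : ℕ) := by
  have htriv : ∀ {g : Finset H → ℝ≥0∞} {M : ℝ≥0∞}, (∀ B, IsBasisOf V B ∅ → g B ≤ M) →
      cost V t c (basis2 0 ∅) g ≤ M := by
    intro g M hgM
    have h := cost_trivialAlg_le t c hV hδ (G := ∅) (by simp) hgM
    simpa [basis2, trivialBound] using h
  unfold basis1
  split_ifs with hG
  · have hG0 : G = ∅ := by simpa using hG
    subst hG0
    exact (htriv hg).trans (by simp)
  have hempty : ∀ F : Finset H, IsBasisOf V ∅ F := fun F => by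
    obtain ⟨B, hB⟩ := exists_isBasisOf V F
    have : B = ∅ := by simpa using hδ B (hB.isBasis hV)
    exact this ▸ hB
  have hVG : V ∅ = V G := (hempty G).1.2
  set Φ : Finset H → ℝ≥0∞ := fun W => if W = ∅ then ((c + G.card : ℕ) : ℝ≥0∞) else ⊤ with hΦ
  refine (cost_loop_le V t c _ g Φ ?_ ∅).trans (by simp [hΦ])
  intro W
  by_cases hW : W = ∅
  swap
  · simp only [hΦ, hW, if_false, le_top]
  simp only [hΦ, hW, if_true, Nat.cast_zero, zero_mul, Nat.floor_zero, Finset.powersetCard_zero]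
  rw [Nat.cast_add]
  refine add_le_add_right ?_ _
  rw [← add_zero (G.card : ℝ≥0∞)]
  refine cost_choose_le V t c (Finset.singleton_nonempty _) _ _ _ 0 (fun _ => False) (by simp) ?_
  intro R hR
  rw [Finset.mem_singleton.1 hR, Finset.union_empty, cost_bind]
  refine htriv fun C hC => ?_
  rw [cost_bind]
  refine (cost_violators_sdiff_le t c hV C G _).trans ?_
  simp only [mul_zero, ite_self]
  refine add_le_add_right ?_ _
  have hX : G.filter (· ∈ V C) = ∅ := by
    refine Finset.filter_eq_empty_iff.2 fun h hh hhV => ?_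
    rw [hC.1.2, hVG] at hhV
    exact hV.notMem_of_mem hhV hh
  rw [hX, cost_ret, if_pos rfl, Sum.elim_inr]
  exact hg C (hC.of_violators_eq (Finset.empty_subset _) hVG)

end Clarkson

/-! ### Arithmetic of the bounds -/

namespace Clarkson

theorem trivialBound_le {δ : ℕ} (hδ : 1 ≤ δ) : trivialBound δ ≤ 49 * δ ^ (10 * δ) := by
  rcases hδ.eq_or_lt with rfl | hδ2
  · norm_num [trivialBound]
  have h8 : 2 ^ 3 ≤ δ ^ 3 := Nat.pow_le_pow_left hδ2 3
  have h7 : 7 * δ ^ 2 ≤ δ ^ 5 :=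
    calc 7 * δ ^ 2 ≤ δ ^ 3 * δ ^ 2 := Nat.mul_le_mul_right _ (by omega)
      _ = δ ^ 5 := by ring
  have h1 : 1 ≤ δ ^ 2 := Nat.one_le_pow _ _ hδ
  calc trivialBound δ ≤ (7 * δ ^ 2) ^ δ * (7 * δ ^ 2) := by
        unfold trivialBound
        gcongr
        · omega
        · norm_num
    _ = (7 * δ ^ 2) ^ (δ + 1) := (pow_succ _ _).symm
    _ ≤ (δ ^ 5) ^ (δ + 1) := Nat.pow_le_pow_left h7 _
    _ ≤ (δ ^ 5) ^ (2 * δ) := Nat.pow_le_pow_right (by positivity) (by omega)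
    _ = δ ^ (10 * δ) := by rw [← pow_mul]; ring_nf
    _ ≤ 49 * δ ^ (10 * δ) := Nat.le_mul_of_pos_left _ (by norm_num)

theorem basis2Bound_ne_top (δ c m : ℕ) : basis2Bound δ c m ≠ ⊤ := by
  unfold basis2Bound
  finiteness

theorem roundBound_ne_top (δ c n : ℕ) : roundBound δ c n ≠ ⊤ := by
  have := basis2Bound_ne_top δ c ⌊3 * δ * √(n : ℝ)⌋₊
  unfold roundBound
  finiteness

theorem basis2Bound_le_ofReal (δ m : ℕ) {T L : ℝ} (hT : (trivialBound δ : ℝ) + m ≤ T)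
    (hL : Real.logb 2 m ≤ L) (hL0 : 0 ≤ L) :
    basis2Bound δ 0 m ≤ ENNReal.ofReal (T * (4 * (δ * L) + 2)) := by
  have hT0 : 0 ≤ T := le_trans (by positivity) hT
  rw [ENNReal.ofReal_mul hT0, ENNReal.ofReal_add (by positivity) (by norm_num)]
  unfold basis2Bound
  gcongr
  · rw [← ENNReal.ofReal_natCast]
    refine ENNReal.ofReal_le_ofReal ?_
    push_cast
    linarith
  · norm_num

theorem basis2Bound_le {δ m : ℕ} (hδ : 1 ≤ δ) (hm : m ≤ 9 * δ ^ 2) :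
    basis2Bound δ 0 m ≤ ((10000 * δ ^ (40 * δ) : ℕ) : ℝ≥0∞) := by
  set P : ℕ := δ ^ (10 * δ) with hP
  have hT : trivialBound δ ≤ 49 * P := trivialBound_le hδ
  have h2 : δ ^ 2 ≤ P := Nat.pow_le_pow_right hδ (by omega)
  have h3 : δ ^ 3 ≤ P := Nat.pow_le_pow_right hδ (by omega)
  have h1 : 1 ≤ P := Nat.one_le_pow _ _ hδ
  have hlog : Real.logb 2 m ≤ (9 * δ ^ 2 : ℕ) := by
    refine le_trans ?_ (Nat.cast_le.2 hm)
    rcases Nat.eq_zero_or_pos m with rfl | hm0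
    · simp
    rw [Real.logb_le_iff_le_rpow (by norm_num) (by exact_mod_cast hm0), Real.rpow_natCast]
    exact_mod_cast Nat.lt_two_pow_self.le
  refine (basis2Bound_le_ofReal δ m (T := ((58 * P : ℕ) : ℝ)) ?_ hlog (Nat.cast_nonneg _)).trans ?_
  · exact_mod_cast (by omega)
  · rw [← ENNReal.ofReal_natCast]
    refine ENNReal.ofReal_le_ofReal ?_
    have h4 : 58 * P * (4 * (δ * (9 * δ ^ 2)) + 2) ≤ 10000 * δ ^ (40 * δ) :=
      calc 58 * P * (4 * (δ * (9 * δ ^ 2)) + 2) = 58 * P * (36 * δ ^ 3 + 2) := by ring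
        _ ≤ 58 * P * (36 * P + 2 * P) := by gcongr; omega
        _ = 2204 * P ^ 2 := by ring
        _ ≤ 10000 * P ^ 4 := Nat.mul_le_mul (by norm_num) (Nat.pow_le_pow_right h1 (by norm_num))
        _ = 10000 * δ ^ (40 * δ) := by rw [hP, ← pow_mul]; ring_nf
    exact_mod_cast h4

theorem two_mul_roundBound_le {δ n : ℕ} (hδ : 1 ≤ δ) (hn : 9 * δ ^ 2 < n) :
    2 * roundBound δ 0 n * (δ + 1) ≤ ((10000 * (δ * n + δ ^ (40 * δ)) : ℕ) : ℝ≥0∞) := by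
  set P : ℝ := ((δ ^ (10 * δ) : ℕ) : ℝ) with hP
  have hT : (trivialBound δ : ℝ) ≤ 49 * P := by
    rw [hP]
    exact_mod_cast trivialBound_le hδ
  have hd : (1 : ℝ) ≤ δ := by exact_mod_cast hδ
  have hP2 : (δ : ℝ) ^ 2 ≤ P := by
    rw [hP]
    exact_mod_cast Nat.pow_le_pow_right hδ (show 2 ≤ 10 * δ by omega)
  have hP9 : (δ : ℝ) ^ 9 ≤ P := by
    rw [hP]
    exact_mod_cast Nat.pow_le_pow_right hδ (show 9 ≤ 10 * δ by omega)
  have hP1 : 1 ≤ P := by nlinarith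
  have hn' : 9 * (δ : ℝ) ^ 2 < n := by exact_mod_cast hn
  -- All quantities are compared through the fourth root `q` of `n`.
  set q : ℝ := √√(n : ℝ) with hq
  have hq2 : q ^ 2 = √(n : ℝ) := Real.sq_sqrt (Real.sqrt_nonneg _)
  have hq4 : q ^ 4 = n := by
    rw [show q ^ 4 = (q ^ 2) ^ 2 by ring, hq2, Real.sq_sqrt (Nat.cast_nonneg _)]
  have hq1 : 1 ≤ q := by
    refine Real.le_sqrt_of_sq_le (Real.le_sqrt_of_sq_le ?_)
    nlinarith
  have hδq : 3 * (δ : ℝ) ≤ q ^ 2 := by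
    rw [hq2]
    refine Real.le_sqrt_of_sq_le ?_
    nlinarith
  have hmle : ((⌊3 * δ * √(n : ℝ)⌋₊ : ℕ) : ℝ) ≤ 3 * δ * q ^ 2 := by
    rw [hq2]
    exact Nat.floor_le (by positivity)
  have hlog : Real.logb 2 (⌊3 * δ * √(n : ℝ)⌋₊ : ℕ) ≤ 8 * q := by
    have h1 : (1 : ℝ) ≤ (⌊3 * δ * √(n : ℝ)⌋₊ : ℕ) := by
      have : 1 ≤ ⌊3 * δ * √(n : ℝ)⌋₊ := Nat.le_floor (by rw [← hq2, Nat.cast_one]; nlinarith)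
      exact_mod_cast this
    have h2 : ((⌊3 * δ * √(n : ℝ)⌋₊ : ℕ) : ℝ) ≤ q ^ 4 := by nlinarith
    refine (Real.logb_le_logb_of_le (by norm_num) (by linarith) h2).trans ?_
    rw [Real.logb, div_le_iff₀ (Real.log_pos (by norm_num)), Real.log_pow]
    have h3 := Real.log_le_sub_one_of_pos (show 0 < q by linarith)
    have h4 := Real.log_two_gt_d9
    push_cast
    nlinarith
  have hcube : (δ : ℝ) * (δ ^ 2 * q ^ 3) ≤ δ * q ^ 4 + P := by
    rcases le_total ((δ : ℝ) ^ 2) q with h | h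
    · have : (δ : ℝ) * (δ ^ 2 * q ^ 3) ≤ δ * (q * q ^ 3) := by gcongr
      nlinarith
    · have : (δ : ℝ) * (δ ^ 2 * q ^ 3) ≤ δ * (δ ^ 2 * (δ ^ 2) ^ 3) := by gcongr
      have h' : (δ : ℝ) * (δ ^ 2 * (δ ^ 2) ^ 3) = δ ^ 9 := by ring
      have : 0 ≤ (δ : ℝ) * q ^ 4 := by positivity
      linarith
  have hlin : (δ : ℝ) * (P * (δ * q)) ≤ δ * q ^ 4 + P ^ 4 := by
    have h1 : (δ : ℝ) * (P * (δ * q)) ≤ P ^ 2 * q := by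
      calc (δ : ℝ) * (P * (δ * q)) = P * δ ^ 2 * q := by ring
        _ ≤ P * P * q := by gcongr
        _ = P ^ 2 * q := by ring
    have h2 : P ^ 2 * q ≤ P ^ 4 + q ^ 2 := by
      nlinarith [sq_nonneg (P ^ 2 - q), sq_nonneg P, sq_nonneg q, sq_nonneg (P ^ 2)]
    have h3 : q ^ 2 ≤ q ^ 4 := pow_le_pow_right₀ hq1 (by norm_num)
    have h4 : q ^ 4 ≤ δ * q ^ 4 := le_mul_of_one_le_left (by positivity) hd
    linarith
  have hPle : P ≤ P ^ 4 := le_self_pow₀ hP1 (by norm_num)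
  have hreal : 2 * ((49 * P + 3 * δ * q ^ 2) * (4 * (δ * (8 * q)) + 2) + n) * (δ + 1) ≤
      10000 * (δ * n + P ^ 4) := by
    rw [← hq4]
    have h1 : 4 * (δ * (8 * q)) + 2 ≤ 34 * (δ * q) := by nlinarith
    calc _ ≤ 2 * ((49 * P + 3 * δ * q ^ 2) * (34 * (δ * q)) + q ^ 4) * (δ + δ) := by gcongr
      _ = 4 * (1666 * (δ * (P * (δ * q))) + 102 * (δ * (δ ^ 2 * q ^ 3)) + δ * q ^ 4) := by ring
      _ ≤ 4 * (1666 * (δ * q ^ 4 + P ^ 4) + 102 * (δ * q ^ 4 + P ^ 4) + δ * q ^ 4) := by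
          gcongr
          linarith
      _ ≤ 10000 * (δ * q ^ 4 + P ^ 4) := by
          have : 0 ≤ (δ : ℝ) * q ^ 4 := by positivity
          have : 0 ≤ P ^ 4 := by positivity
          linarith
  have hb := basis2Bound_le_ofReal δ _ (add_le_add hT hmle) hlog (by positivity)
  have hrb : roundBound δ 0 n ≤
      ENNReal.ofReal ((49 * P + 3 * δ * q ^ 2) * (4 * (δ * (8 * q)) + 2) + n) := by
    rw [ENNReal.ofReal_add (by positivity) (Nat.cast_nonneg _), ENNReal.ofReal_natCast]
    unfold roundBound
    rw [Nat.cast_zero, zero_add]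
    gcongr
  calc 2 * roundBound δ 0 n * (δ + 1)
      ≤ ENNReal.ofReal 2 *
          ENNReal.ofReal ((49 * P + 3 * δ * q ^ 2) * (4 * (δ * (8 * q)) + 2) + n) *
          ENNReal.ofReal (δ + 1) := by
        gcongr
        · norm_num
        · rw [ENNReal.ofReal_add (by positivity) (by norm_num)]
          simp
    _ = ENNReal.ofReal
          (2 * ((49 * P + 3 * δ * q ^ 2) * (4 * (δ * (8 * q)) + 2) + n) * (δ + 1)) := by
        rw [← ENNReal.ofReal_mul (by norm_num), ← ENNReal.ofReal_mul (by positivity)]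
    _ ≤ ENNReal.ofReal (10000 * (δ * n + P ^ 4)) := ENNReal.ofReal_le_ofReal hreal
    _ = ((10000 * (δ * n + δ ^ (40 * δ)) : ℕ) : ℝ≥0∞) := by
        rw [← ENNReal.ofReal_natCast, hP]
        congr 1
        push_cast
        rw [← pow_mul]
        ring_nf

end Clarkson

/-! ### Correctness and expected number of calls -/

theorem mainTheorem2 :
    ∃ C c : ℕ, ∀ (H : Type u) [Fintype H] [DecidableEq H] (V : Finset H → Finset H),
      IsViolatorSpace V →
      ∀ δ : ℕ, δ = combDim V →
        Prog.outputProb V (Clarkson.basis1 δ Finset.univ) {B | IsBasisOf V B Finset.univ} = 1 ∧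
        (1 ≤ δ → Prog.expectedCalls V (Clarkson.basis1 δ (Finset.univ : Finset H)) ≤
          ((C * (δ * Fintype.card H + δ ^ (c * δ)) : ℕ) : ℝ≥0∞)) ∧
        (δ = 0 → Prog.expectedCalls V (Clarkson.basis1 δ (Finset.univ : Finset H)) ≤
          (Fintype.card H : ℝ≥0∞)) := by
  classical
  refine ⟨10000, 40, fun H _ _ V hV δ hdim => ?_⟩
  have hδ : ∀ B, IsBasis V B → B.card ≤ δ := fun B hB => hdim ▸ hB.card_le_combDim
  set S : Set (Finset H) := {B | IsBasisOf V B Finset.univ} with hS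
  set g : Finset H → ℝ≥0∞ := fun B => if B ∈ S then 0 else ⊤ with hg
  have hgS : ∀ B, IsBasisOf V B Finset.univ → g B ≤ 0 := fun B hB => by
    have : B ∈ S := hB
    simp [hg, this]
  have hcard : (Finset.univ : Finset H).card = Fintype.card H := Finset.card_univ
  rcases Nat.eq_zero_or_pos δ with rfl | hδ1
  · have hcost : ∀ t c, Prog.cost V t c (Clarkson.basis1 0 Finset.univ) g ≤
        (c + Fintype.card H : ℕ) := fun t c => by
      simpa only [hcard] using Clarkson.cost_basis1_zero_le t c hV hδ Finset.univ hgS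
    refine ⟨Prog.outputProb_eq_one V (ENNReal.natCast_ne_top _) fun t => hcost t 1,
      fun h => absurd h (by norm_num), fun _ => ?_⟩
    simpa using Prog.expectedCalls_le V fun t => hcost t 0
  refine ⟨?_, fun _ => ?_, fun h => absurd h (by omega)⟩
  all_goals
    rcases le_or_gt (Finset.univ : Finset H).card (9 * δ ^ 2) with hn | hn
  · refine Prog.outputProb_eq_one V (K := Clarkson.basis2Bound δ 1 (Finset.univ : Finset H).card)
      (Clarkson.basis2Bound_ne_top _ _ _) fun t => ?_
    rw [Clarkson.basis1, if_pos hn]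
    simpa using Clarkson.cost_basis2_le t 1 hV hδ1 hδ hgS
  · have hfin := Clarkson.roundBound_ne_top δ 1 (Finset.univ : Finset H).card
    refine Prog.outputProb_eq_one V
      (K := 0 + 2 * Clarkson.roundBound δ 1 (Finset.univ : Finset H).card * (δ + 1))
      (by finiteness) fun t => ?_
    exact Clarkson.cost_basis1_loop_le t 1 hV hδ1 hδ hn hgS
  · refine Prog.expectedCalls_le V (g := g) fun t => ?_
    rw [Clarkson.basis1, if_pos hn]
    refine (Clarkson.cost_basis2_le t 0 hV hδ1 hδ hgS).trans ?_
    rw [add_zero]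
    refine (Clarkson.basis2Bound_le hδ1 hn).trans ?_
    exact_mod_cast Nat.mul_le_mul_left _ (Nat.le_add_left _ _)
  · refine Prog.expectedCalls_le V (g := g) fun t => ?_
    refine (Clarkson.cost_basis1_loop_le t 0 hV hδ1 hδ hn hgS).trans ?_
    rw [zero_add, ← hcard]
    exact Clarkson.two_mul_roundBound_le hδ1 hn
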